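/- Let $X=\{0,1\}^{\mathbb N}$ with coordinates $x_1,x_2,\dots$, and let $\mathcal R$ be the tail equivalence relation on $X$: $x\sim y$ if there is $N$ with $x_i=y_i$ for all $i\ge N$. Let $\pi$ be a probability distribution on $\{0,1\}$ with $\pi(0),\pi(1)>0$ and let $P=(P_{i,j})_{i,j\in\{0,1\}}$ be a stochastic matrix with all entries strictly positive ($\pi$ need not be $P$-invariant). Let $\mu$ be the Markov measure on $X$ with initial distribution $\pi$ and transition matrix $P$, that is, the Borel probability measure with $$\mu(\{x: x_1=a_1,\dots,x_k=a_k\})=\pi(a_1)P_{a_1,a_2}\cdots P_{a_{k-1},a_k}$$ for all $k\ge 1$ and $a_1,\dots,a_k\in\{0,1\}$. Let $\Gamma$ be the subgroup of the multiplicative group $\mathbb R^*_+$ of positive reals generated by $\frac{P_{0,0}}{P_{1,1}}$ and $\frac{P_{0,0}^2}{P_{0,1}P_{1,0}}$. Then $\mathcal R$ is $\mu$-ergodic (every $\mathcal R$-invariant Borel set is null or conull), and 1. if $\Gamma=\{1\}$, then $(\mathcal R,\mu)$ is of type $II_1$; 2. if $\Gamma=\{\lambda^n: n\in\mathbb Z\}$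 for some $\lambda\in(0,1)$, then $(\mathcal R,\mu)$ is of type $III_\lambda$; 3. if $\Gamma$ is dense in $\mathbb R^*_+$, then $(\mathcal R,\mu)$ is of type $III_1$. Here the types of a countable Borel equivalence relation $\mathcal R$ that is nonsingular and ergodic for a non-atomic measure $\mu$ are defined as follows. Let $\Delta:\mathcal R\to\mathbb R^*_+$ be the Radon-Nikodym cocycle: $\Delta(x,\gamma x)=\frac{d(\mu\circ\gamma)}{d\mu}(x)$ for a.e. $x$ and for all $\gamma$ in a countable group of Borel bijections whose orbits are the $\mathcal R$-classes. A cocycle $\alpha$ of $\mathcal R$ with values in a locally compact second countable abelian group $G$ is ergodic if the relation "$(x,g)\sim(y,h)$ iff $(x,y)\in\mathcal R$ and $h=\alpha(x,y)g$" on $X\times G$ is ergodic for the product of $\mu$ and a Haar measure of $G$; two cocycles $\alpha,\beta$ are cohomologous if $\alpha(x,y)=\varphi(x)^{-1}\beta(x,y)\varphi(y)$ on a conull set for some Borel $\varphi:X\to G$. Type $II_1$: there is a finite $\mathcal R$-invariant measure equivalent to $\mu$. Type $III_\lambda$, $0<\lambda<1$: $\Delta$ is cohomologous to a cocycle with values in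 $\{\lambda^n: n\in\mathbb Z\}$ which is ergodic as a cocycle with values in this (discrete) group. Type $III_1$: $\Delta$ is ergodic. -/

import Mathlib

open MeasureTheory

noncomputable section

namespace OrbitType

/-! ### Nonsingular countable equivalence relations -/

section Relations

variable {X : Type*} [MeasurableSpace X]

/-- A countable Borel equivalence relation: a measurable subset of `X × X` all of whose classes
are countable. -/
structure IsCountableBorel (R : Setoid X) : Prop where
  measurableSet : MeasurableSet {p : X × X | R p.1 p.2}
  countable_class : ∀ x, {y | R x y}.Countable

/-- `R` is `μ`-nonsingular: the saturation of a null set is null. -/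
def IsNonsingular (R : Setoid X) (μ : Measure X) : Prop :=
  ∀ A, MeasurableSet A → μ A = 0 → μ {y | ∃ x ∈ A, R x y} = 0

/-- Ergodicity of a relation `r`: every measurable set invariant under `r` is null or conull.
(For an equivalence relation, invariant means saturated.) -/
def IsErgodicRel (r : X → X → Prop) (μ : Measure X) : Prop :=
  ∀ A, MeasurableSet A → (∀ x y, r x y → (x ∈ A ↔ y ∈ A)) → μ A = 0 ∨ μ Aᶜ = 0

/-- `Γ` is a countable group of Borel bijections of `X` whose orbits are the classes of `R`.
(Inverses of elements of `Γ` are in `Γ`, hence are measurable, too.) -/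
structure Generates (Γ : Subgroup (Equiv.Perm X)) (R : Setoid X) : Prop where
  countable : Countable Γ
  measurable : ∀ γ ∈ Γ, Measurable γ
  rel_iff : ∀ x y, R x y ↔ ∃ γ ∈ Γ, γ x = y

/-- The measure `ν` is `R`-invariant: it is preserved by a countable group of Borel bijections
that generates `R`. -/
def IsInvariantMeasure (R : Setoid X) (ν : Measure X) : Prop :=
  ∃ Γ : Subgroup (Equiv.Perm X), Generates Γ R ∧ ∀ γ ∈ Γ, ν.map γ = ν

/-! ### Cocycles

A map on `R` with values in `G` is represented by a function `X → X → G`;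
its values off `R` are never used. -/

/-- `α` is a (Borel) cocycle of `R` (mod `μ`) with values in `G`. -/
structure IsCocycle {G : Type*} [CommGroup G] [MeasurableSpace G]
    (R : Setoid X) (μ : Measure X) (α : X → X → G) : Prop where
  measurable : Measurable fun p : {p : X × X // R p.1 p.2} => α p.1.1 p.1.2
  mul_eq : ∃ A : Set X, MeasurableSet A ∧ μ Aᶜ = 0 ∧
    ∀ x ∈ A, ∀ y ∈ A, ∀ z ∈ A, R x y → R y z → α x y * α y z = α x z

/-- The cocycles `α` and `β` are cohomologous. -/
def Cohomologous {G : Type*} [CommGroup G] [MeasurableSpace G]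
    (R : Setoid X) (μ : Measure X) (α β : X → X → G) : Prop :=
  ∃ φ : X → G, Measurable φ ∧ ∃ B : Set X, MeasurableSet B ∧ μ Bᶜ = 0 ∧
    ∀ x ∈ B, ∀ y ∈ B, R x y → α x y = (φ x)⁻¹ * β x y * φ y

/-- The `α`-skew product relation on `X × G`: `(x, g) ∼ (y, h)` if `R x y` and `h = α(x, y) g`. -/
def SkewProduct {G : Type*} [CommGroup G] (R : Setoid X) (α : X → X → G) :
    X × G → X × G → Prop :=
  fun p q => R p.1 q.1 ∧ q.2 = α p.1 q.1 * p.2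

/-- `α` is an ergodic cocycle: its skew product is ergodic with respect to the product of `μ`
and a Haar measure of `G`. (A Haar measure is unique up to a positive factor.) -/
def IsErgodicCocycle {G : Type*} [CommGroup G] [TopologicalSpace G] [MeasurableSpace G]
    (R : Setoid X) (μ : Measure X) (α : X → X → G) : Prop :=
  ∃ ν : Measure G, ν.IsHaarMeasure ∧ IsErgodicRel (SkewProduct R α) (μ.prod ν)

/-- The multiplicative group of positive reals, with the topology, the Borel structure and the
multiplication of `ℝ`. -/
abbrev PosReal : Type := {x : ℝ // 0 < x}

/-- `Δ` is (a version of) the Radon-Nikodym cocycle of `(R, μ)`: for a countable group `Γ` of Borel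
bijections that generates `R`, one has `Δ(x, γ x) = (d(μ ∘ γ) / dμ)(x)` for almost every `x`, for
every `γ ∈ Γ`. Here `(μ ∘ γ)(A) = μ(γ(A))`, i.e. `μ ∘ γ` is the image of `μ` under `γ⁻¹`. -/
structure IsRadonNikodymCocycle (R : Setoid X) (μ : Measure X) (Δ : X → X → PosReal) : Prop where
  isCocycle : IsCocycle R μ Δ
  eq_rnDeriv : ∃ Γ : Subgroup (Equiv.Perm X), Generates Γ R ∧ ∀ γ ∈ Γ,
    ∀ᵐ x ∂μ, ENNReal.ofReal (Δ x (γ x)) = (μ.map (γ⁻¹ : Equiv.Perm X)).rnDeriv μ x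

/-! ### Krieger's types -/

/-- The standing assumptions under which the type of `(R, μ)` is defined. -/
structure IsErgodicNonsingular (R : Setoid X) (μ : Measure X) : Prop where
  countableBorel : IsCountableBorel R
  nonsingular : IsNonsingular R μ
  noAtoms : ∀ x, μ {x} = 0
  ergodic : IsErgodicRel R μ

/-- Type `II₁`: there is a finite `R`-invariant measure equivalent to `μ`. -/
def IsTypeIIone (R : Setoid X) (μ : Measure X) : Prop :=
  IsErgodicNonsingular R μ ∧
    ∃ ν : Measure X, IsFiniteMeasure ν ∧ ν ≪ μ ∧ μ ≪ ν ∧ IsInvariantMeasure R ν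

/-- Type `III_l`, where `0 < l < 1`: the Radon-Nikodym cocycle is cohomologous to a cocycle `β`
with values in the subgroup `{l ^ n | n ∈ ℤ}` that is ergodic as a cocycle with values in this
subgroup. -/
def IsTypeIIIlam (R : Setoid X) (μ : Measure X) (l : PosReal) : Prop :=
  IsErgodicNonsingular R μ ∧ l < 1 ∧
    ∃ Δ : X → X → PosReal, IsRadonNikodymCocycle R μ Δ ∧
      ∃ β : X → X → Subgroup.zpowers l, IsCocycle R μ β ∧
        Cohomologous R μ Δ (fun x y => (β x y : PosReal)) ∧ IsErgodicCocycle R μ β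

/-- Type `III₁`: the Radon-Nikodym cocycle is ergodic. -/
def IsTypeIIIone (R : Setoid X) (μ : Measure X) : Prop :=
  IsErgodicNonsingular R μ ∧
    ∃ Δ : X → X → PosReal, IsRadonNikodymCocycle R μ Δ ∧ IsErgodicCocycle R μ Δ

end Relations

/-! ### The tail relation -/

/-- The tail equivalence relation on sequences: `x ∼ y` if `x i = y i` for all large `i`. -/
def tailRel (A : Type*) : Setoid (ℕ → A) where
  r x y := ∃ N, ∀ i, N ≤ i → x i = y i
  iseqv :=
    { refl := fun _ => ⟨0, fun _ _ => rfl⟩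
      symm := fun ⟨N, h⟩ => ⟨N, fun i hi => (h i hi).symm⟩
      trans := fun ⟨N, h⟩ ⟨M, k⟩ => ⟨max N M, fun i hi =>
        (h i (le_of_max_le_left hi)).trans (k i (le_of_max_le_right hi))⟩ }

/-! ### Markov measures on `{0,1}^ℕ`

Coordinates are numbered from `0`, so that `P n` governs the step from coordinate `n` to
coordinate `n + 1`. -/

/-- `p` is a non-degenerate distribution on `{0,1}`. -/
def IsPosDistribution (p : Fin 2 → ℝ) : Prop :=
  (∀ a, 0 < p a) ∧ p 0 + p 1 = 1

/-- Choose a letter by means of a number `u` that is uniform on `[0,1]`: the letter is `0` if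
`u < p 0`, else `1`. -/
def chooseLetter (p : Fin 2 → ℝ) (u : ℝ) : Fin 2 := if u < p 0 then 0 else 1

/-- The path of the Markov chain driven by the numbers `u 0, u 1, …`. -/
def markovPath (lam : Fin 2 → ℝ) (P : ℕ → Matrix (Fin 2) (Fin 2) ℝ) (u : ℕ → ℝ) : ℕ → Fin 2
  | 0 => chooseLetter lam (u 0)
  | n + 1 => chooseLetter (P n (markovPath lam P u n)) (u (n + 1))

/-- The uniform distribution on `[0,1]`. -/
def uniform01 : Measure ℝ := volume.restrict (Set.Icc 0 1)

instance : IsProbabilityMeasure uniform01 := ⟨by simp [uniform01]⟩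

/-- The Markov measure determined by an initial distribution `lam` and stochastic matrices `P n`,
realized as the law of a Markov chain driven by independent uniform variables. It is the measure
with the cylinder values given in `markovMeasure_cylinder`. -/
def markovMeasure (lam : Fin 2 → ℝ) (P : ℕ → Matrix (Fin 2) (Fin 2) ℝ) : Measure (ℕ → Fin 2) :=
  (Measure.infinitePi fun _ : ℕ => uniform01).map (markovPath lam P)

/-- The subgroup of the positive reals generated by `P₀₀ / P₁₁` and `P₀₀² / (P₀₁ P₁₀)`. -/
def ratioGroup (P : Matrix (Fin 2) (Fin 2) ℝ) (hP : ∀ i j, 0 < P i j) : Subgroup PosReal :=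
  Subgroup.closure
    {⟨P 0 0 / P 1 1, div_pos (hP 0 0) (hP 1 1)⟩,
      ⟨P 0 0 ^ 2 / (P 0 1 * P 1 0), div_pos (pow_pos (hP 0 0) 2) (mul_pos (hP 0 1) (hP 1 0))⟩}

lemma measurable_chooseLetter (p : Fin 2 → ℝ) : Measurable (chooseLetter p) :=
  Measurable.ite measurableSet_Iio measurable_const measurable_const

lemma measurable_markovPath (lam : Fin 2 → ℝ) (P : ℕ → Matrix (Fin 2) (Fin 2) ℝ) :
    Measurable (markovPath lam P) := by
  refine measurable_pi_lambda _ fun n => ?_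
  induction n with
  | zero => exact (measurable_chooseLetter lam).comp (measurable_pi_apply 0)
  | succ n ih =>
    have h : Measurable fun q : Fin 2 × ℝ => chooseLetter (P n q.1) q.2 :=
      measurable_from_prod_countable_right fun a => measurable_chooseLetter (P n a)
    exact h.comp (ih.prodMk (measurable_pi_apply (n + 1)))

instance (lam : Fin 2 → ℝ) (P : ℕ → Matrix (Fin 2) (Fin 2) ℝ) :
    IsProbabilityMeasure (markovMeasure lam P) :=
  Measure.isProbabilityMeasure_map (measurable_markovPath lam P).aemeasurable

lemma uniform01_chooseLetter {p : Fin 2 → ℝ} (hp : IsPosDistribution p) (a : Fin 2) :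
    uniform01 (chooseLetter p ⁻¹' {a}) = ENNReal.ofReal (p a) := by
  have h0 := hp.1 0
  have h1 := hp.1 1
  have h2 := hp.2
  rw [uniform01, Measure.restrict_apply (measurable_chooseLetter p (measurableSet_singleton a))]
  fin_cases a
  · have : chooseLetter p ⁻¹' {0} ∩ Set.Icc 0 1 = Set.Ico 0 (p 0) := by
      ext u
      simp only [chooseLetter, Set.mem_inter_iff, Set.mem_preimage, Set.mem_singleton_iff,
        Set.mem_Icc, Set.mem_Ico]
      split_ifs with h <;> simp <;> grind
    simp [this]
  · have : chooseLetter p ⁻¹' {1} ∩ Set.Icc 0 1 = Set.Icc (p 0) 1 := by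
      ext u
      simp only [chooseLetter, Set.mem_inter_iff, Set.mem_preimage, Set.mem_singleton_iff,
        Set.mem_Icc]
      split_ifs with h <;> simp <;> grind
    simp only [Fin.mk_one, this, Real.volume_Icc]
    congr 1
    linarith

/-- The defining formula of the Markov measure:
`μ [a₀, …, aₖ] = lam(a₀) P⁽⁰⁾(a₀, a₁) ⋯ P⁽ᵏ⁻¹⁾(aₖ₋₁, aₖ)`. -/
theorem markovMeasure_cylinder {lam : Fin 2 → ℝ} {P : ℕ → Matrix (Fin 2) (Fin 2) ℝ}
    (hlam : IsPosDistribution lam) (hP : ∀ n i, IsPosDistribution (P n i)) (k : ℕ)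
    (a : ℕ → Fin 2) :
    markovMeasure lam P {x | ∀ i ≤ k, x i = a i} =
      ENNReal.ofReal (lam (a 0) * ∏ i ∈ Finset.range k, P i (a i) (a (i + 1))) := by
  set p : ℕ → Fin 2 → ℝ := fun n => Nat.casesOn n lam fun m => P m (a m) with hp
  have hpos : ∀ n, IsPosDistribution (p n) := fun n => by
    cases n with
    | zero => exact hlam
    | succ m => exact hP m (a m)
  have hset : markovPath lam P ⁻¹' {x | ∀ i ≤ k, x i = a i} =
      Set.pi (Finset.range (k + 1)) fun i => chooseLetter (p i) ⁻¹' {a i} := by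
    ext u
    simp only [Set.mem_preimage, Set.mem_ofPred_eq, Set.mem_pi, Finset.coe_range, Set.mem_Iio,
      Set.mem_singleton_iff, Nat.lt_succ_iff]
    constructor
    · intro h i hi
      cases i with
      | zero => exact h 0 hi
      | succ m =>
        have h1 := h (m + 1) hi
        rw [markovPath, h m (by omega)] at h1
        exact h1
    · intro h i
      induction i with
      | zero => exact h 0
      | succ m ih =>
        intro hi
        rw [markovPath, ih (by omega)]
        exact h (m + 1) hi
  have hmeas : MeasurableSet {x : ℕ → Fin 2 | ∀ i ≤ k, x i = a i} := by
    have : {x : ℕ → Fin 2 | ∀ i ≤ k, x i = a i} =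
        ⋂ i, ⋂ (_ : i ≤ k), (fun x : ℕ → Fin 2 => x i) ⁻¹' {a i} := by
      ext x; simp
    rw [this]
    exact MeasurableSet.iInter fun i => MeasurableSet.iInter fun _ =>
      measurable_pi_apply i (measurableSet_singleton _)
  rw [markovMeasure, Measure.map_apply (measurable_markovPath lam P) hmeas, hset,
    Measure.infinitePi_pi _ fun i _ =>
      measurable_chooseLetter (p i) (measurableSet_singleton (a i)),
    Finset.prod_congr rfl fun i _ => uniform01_chooseLetter (hpos i) (a i),
    ← ENNReal.ofReal_prod_of_nonneg fun i _ => ((hpos i).1 (a i)).le,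
    Finset.prod_range_succ', mul_comm]
  rfl

end OrbitType

end

open OrbitType

open MeasureTheory

noncomputable section

namespace OrbitType

open Filter Topology

/-! ### Cylinders -/

/-- The cylinder of the sequences that agree with `a` up to coordinate `n`. -/
def cyl (n : ℕ) (a : ℕ → Fin 2) : Set (ℕ → Fin 2) := {x | ∀ i ≤ n, x i = a i}

lemma mem_cyl_self (n : ℕ) (a : ℕ → Fin 2) : a ∈ cyl n a := fun _ _ => rfl

lemma cyl_eq_of_mem {n : ℕ} {a b : ℕ → Fin 2} (h : a ∈ cyl n b) : cyl n a = cyl n b := by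
  ext x
  exact ⟨fun hx i hi => (hx i hi).trans (h i hi), fun hx i hi => (hx i hi).trans (h i hi).symm⟩

lemma cyl_anti {m n : ℕ} (h : m ≤ n) (a : ℕ → Fin 2) : cyl n a ⊆ cyl m a :=
  fun _ hx i hi => hx i (hi.trans h)

lemma measurableSet_cyl (n : ℕ) (a : ℕ → Fin 2) : MeasurableSet (cyl n a) := by
  have : cyl n a = ⋂ i, ⋂ (_ : i ≤ n), (fun x : ℕ → Fin 2 => x i) ⁻¹' {a i} := by
    ext x; simp [cyl]
  rw [this]
  exact MeasurableSet.iInter fun i => MeasurableSet.iInter fun _ =>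
    measurable_pi_apply i (measurableSet_singleton _)

/-- Extend a finite word by zeros. -/
def extendWord {n : ℕ} (w : Fin n → Fin 2) (i : ℕ) : Fin 2 := if h : i < n then w ⟨i, h⟩ else 0

lemma mem_cyl_extendWord (n : ℕ) (x : ℕ → Fin 2) :
    x ∈ cyl n (extendWord fun i : Fin (n + 1) => x i) := by
  intro i hi
  simp [extendWord, Nat.lt_succ_iff.2 hi]

/-- A map that depends on the coordinates up to `n` only is measurable. -/
lemma measurable_of_forall_mem_cyl {Y : Type*} [MeasurableSpace Y] (n : ℕ) {f : (ℕ → Fin 2) → Y}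
    (hf : ∀ x y, x ∈ cyl n y → f x = f y) : Measurable f := by
  have h : f = (fun w : Fin (n + 1) → Fin 2 => f (extendWord w)) ∘ fun x i => x i :=
    funext fun x => hf _ _ (mem_cyl_extendWord n x)
  rw [h]
  exact (measurable_of_countable _).comp
    (measurable_pi_lambda _ fun i => measurable_pi_apply (i : ℕ))

/-- A finite measure is determined by the measures of the cylinders of length at least `n`. -/
lemma ext_of_cyl (n : ℕ) {μ ν : Measure (ℕ → Fin 2)} [IsFiniteMeasure μ]
    (h : ∀ k, n ≤ k → ∀ a, μ (cyl k a) = ν (cyl k a)) : μ = ν := by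
  refine Measure.ext_of_generateFrom_of_cover_subset
    (S := {s | ∃ k, n ≤ k ∧ ∃ a, s = cyl k a})
    (T := Set.range fun w : Fin (n + 1) → Fin 2 => cyl n (extendWord w)) ?_ ?_ ?_
    (Set.countable_range _) ?_ (fun s _ => measure_ne_top μ s) ?_
  · apply le_antisymm
    · rw [MeasurableSpace.pi]
      refine iSup_le fun i => ?_
      rw [← measurable_iff_comap_le]
      refine @measurable_to_countable' _ _ _ _ (MeasurableSpace.generateFrom _) _ fun s => ?_
      have : (fun x : ℕ → Fin 2 => x i) ⁻¹' {s} =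
          ⋃ w : {w : Fin (max n i + 1) → Fin 2 // extendWord w i = s},
            cyl (max n i) (extendWord w.1) := by
        ext x
        simp only [Set.mem_preimage, Set.mem_singleton_iff, Set.mem_iUnion, Subtype.exists]
        constructor
        · intro hx
          exact ⟨_, by rw [← hx]; exact (mem_cyl_extendWord _ x i (le_max_right _ _)).symm,
            mem_cyl_extendWord _ x⟩
        · rintro ⟨w, hw, hx⟩
          rw [hx i (le_max_right _ _), hw]
      rw [this]
      refine MeasurableSet.iUnion fun w =>
        MeasurableSpace.measurableSet_generateFrom ⟨_, le_max_left _ _, _, rfl⟩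
    · refine MeasurableSpace.generateFrom_le ?_
      rintro _ ⟨k, -, a, rfl⟩
      exact measurableSet_cyl k a
  · rintro _ ⟨k, hk, a, rfl⟩ _ ⟨m, hm, b, rfl⟩ ⟨x, hxa, hxb⟩
    rw [← cyl_eq_of_mem hxa, ← cyl_eq_of_mem hxb]
    rcases le_total k m with hkm | hkm
    · exact ⟨m, hm, x, Set.inter_eq_right.2 (cyl_anti hkm x)⟩
    · exact ⟨k, hk, x, Set.inter_eq_left.2 (cyl_anti hkm x)⟩
  · rintro _ ⟨w, rfl⟩
    exact ⟨n, le_rfl, _, rfl⟩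
  · refine Set.eq_univ_of_forall fun x => ?_
    exact ⟨_, ⟨fun i : Fin (n + 1) => x i, rfl⟩, mem_cyl_extendWord n x⟩
  · rintro _ ⟨k, hk, a, rfl⟩
    exact h k hk a

/-- The conditional probability of `A` given the coordinates `a 0, …, a n`. -/
def ratio (μ : Measure (ℕ → Fin 2)) (A : Set (ℕ → Fin 2)) (n : ℕ) (a : ℕ → Fin 2) : ℝ :=
  μ.real (A ∩ cyl n a) / μ.real (cyl n a)

lemma iSup_piLE_eq_pi :
    (⨆ n, (Filtration.piLE : Filtration ℕ (MeasurableSpace.pi (X := fun _ : ℕ => Fin 2))) n) =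
      MeasurableSpace.pi := by
  refine le_antisymm (iSup_le fun n => Filtration.le _ n) ?_
  conv_lhs => rw [MeasurableSpace.pi]
  refine iSup_le fun i => le_trans ?_ (le_iSup _ i)
  rw [← measurable_iff_comap_le]
  have h : Measurable[MeasurableSpace.comap (Preorder.restrictLe i) MeasurableSpace.pi]
      (fun x : ℕ → Fin 2 => Preorder.restrictLe (π := fun _ => Fin 2) i x) :=
    comap_measurable _
  exact (measurable_pi_apply (⟨i, Set.mem_Iic.2 le_rfl⟩ : Set.Iic i)).comp h

/-- Lévy's zero-one law in terms of cylinders. -/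
lemma tendsto_ratio (μ : Measure (ℕ → Fin 2)) [IsProbabilityMeasure μ]
    (hμ : ∀ n a, μ (cyl n a) ≠ 0) {A : Set (ℕ → Fin 2)} (hA : MeasurableSet A) :
    ∀ᵐ x ∂μ, Tendsto (fun n => ratio μ A n x) atTop (𝓝 (A.indicator (fun _ => (1 : ℝ)) x)) := by
  have hint : Integrable (A.indicator fun _ => (1 : ℝ)) μ := (integrable_const 1).indicator hA
  have hlim := hint.tendsto_ae_condExp (ℱ := Filtration.piLE) (by
    rw [iSup_piLE_eq_pi]
    exact stronglyMeasurable_const.indicator hA)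
  filter_upwards [hlim] with x hx
  refine hx.congr fun n => ?_
  set g := μ[A.indicator (fun _ => (1 : ℝ)) | Filtration.piLE n]
  have hdep : DependsOn g (Set.Iic n) :=
    StronglyMeasurable.dependsOn_of_piLE stronglyMeasurable_condExp
  have hmeas : MeasurableSet[Filtration.piLE (X := fun _ : ℕ => Fin 2) n] (cyl n x) := by
    refine ⟨{z | ∀ i : Set.Iic n, z i = x i}, ?_, ?_⟩
    · rw [Set.ofPred_forall]
      exact MeasurableSet.iInter fun i => measurable_pi_apply i (measurableSet_singleton _)
    · ext y
      simp [cyl, Preorder.restrictLe]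
  have h1 : ∫ y in cyl n x, g y ∂μ = ∫ y in cyl n x, A.indicator (fun _ => (1 : ℝ)) y ∂μ :=
    setIntegral_condExp (Filtration.le _ n) hint hmeas
  have h2 : ∫ y in cyl n x, g y ∂μ = ∫ y in cyl n x, g x ∂μ :=
    setIntegral_congr_fun (measurableSet_cyl n x) fun y hy => hdep fun i hi => hy i hi
  rw [h2, setIntegral_const, integral_indicator hA, Measure.restrict_restrict hA,
    setIntegral_const, smul_eq_mul, smul_eq_mul, mul_one] at h1
  have hpos : μ.real (cyl n x) ≠ 0 := (measureReal_ne_zero_iff).2 (hμ n x)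
  rw [ratio, ← h1]
  field_simp

/-! ### Prefixes -/

/-- The word `a 0, …, a (n - 1)`, followed by `x`. -/
def splice (n : ℕ) (a x : ℕ → Fin 2) (i : ℕ) : Fin 2 := if i < n then a i else x (i - n)

/-- Drop the first `n` coordinates. -/
def shift (n : ℕ) (x : ℕ → Fin 2) (i : ℕ) : Fin 2 := x (i + n)

lemma splice_of_lt {n i : ℕ} (h : i < n) (a x : ℕ → Fin 2) : splice n a x i = a i := if_pos h

@[simp] lemma splice_add (n i : ℕ) (a x : ℕ → Fin 2) : splice n a x (n + i) = x i := by
  simp [splice]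

lemma splice_of_le {n i : ℕ} {a x : ℕ → Fin 2} (h : i ≤ n) (hx : x 0 = a n) :
    splice n a x i = a i := by
  rcases h.lt_or_eq with h | rfl
  · exact splice_of_lt h a x
  · rw [← hx]; exact splice_add i 0 a x

lemma splice_shift {n : ℕ} {a x : ℕ → Fin 2} (h : x ∈ cyl n a) : splice n a (shift n x) = x := by
  ext1 i
  rcases lt_or_ge i n with hi | hi
  · rw [splice_of_lt hi, h i hi.le]
  · simp [splice, shift, hi.not_gt, Nat.sub_add_cancel hi]

lemma measurable_shift (n : ℕ) : Measurable (shift n) :=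
  measurable_pi_lambda _ fun i => measurable_pi_apply (i + n)

lemma measurable_splice (n : ℕ) (a : ℕ → Fin 2) : Measurable (splice n a) := by
  refine measurable_pi_lambda _ fun i => ?_
  by_cases h : i < n
  · simp [splice, h]
  · simp only [splice, h, if_false]
    exact measurable_pi_apply _

lemma cyl_inter_shift_cyl {n k : ℕ} {a b : ℕ → Fin 2} (h : b 0 = a n) :
    cyl n a ∩ shift n ⁻¹' cyl k b = cyl (n + k) (splice n a b) := by
  ext x
  constructor
  · rintro ⟨h1, h2⟩ i hi
    rcases lt_or_ge i n with hin | hin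
    · rw [splice_of_lt hin, h1 i hin.le]
    · obtain ⟨j, rfl⟩ := Nat.exists_eq_add_of_le hin
      rw [splice_add, ← h2 j (by omega), shift, add_comm]
  · intro hx
    refine ⟨fun i hi => ?_, fun i hi => ?_⟩
    · rw [hx i (by omega), splice_of_le hi h]
    · rw [shift, add_comm, hx (n + i) (by omega), splice_add]

/-! ### Products along a path -/

section PathProd

variable {H : Type*} [CommMonoid H]

/-- The product of the values of `t` at the first `n` transitions. -/
def pathProd (t : Fin 2 → Fin 2 → H) (n : ℕ) (x : ℕ → Fin 2) : H :=
  ∏ i ∈ Finset.range n, t (x i) (x (i + 1))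

lemma pathProd_congr (t : Fin 2 → Fin 2 → H) {n : ℕ} {x y : ℕ → Fin 2} (h : x ∈ cyl n y) :
    pathProd t n x = pathProd t n y := by
  refine Finset.prod_congr rfl fun i hi => ?_
  rw [Finset.mem_range] at hi
  rw [h i hi.le, h (i + 1) hi]

lemma pathProd_add (t : Fin 2 → Fin 2 → H) (n m : ℕ) (x : ℕ → Fin 2) :
    pathProd t (n + m) x = pathProd t n x * pathProd t m (shift n x) := by
  rw [pathProd, Finset.prod_range_add]
  congr 1
  refine Finset.prod_congr rfl fun i _ => ?_
  rw [shift, shift, show i + 1 + n = n + i + 1 by omega, add_comm i n]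

lemma shift_splice (n : ℕ) (a x : ℕ → Fin 2) : shift n (splice n a x) = x := by
  ext1 i
  rw [shift, add_comm, splice_add]

lemma splice_mem_cyl {n : ℕ} {a x : ℕ → Fin 2} (h : x 0 = a n) : splice n a x ∈ cyl n a :=
  fun _ hi => splice_of_le hi h

lemma pathProd_splice (t : Fin 2 → Fin 2 → H) (n m : ℕ) {a x : ℕ → Fin 2} (h : x 0 = a n) :
    pathProd t (n + m) (splice n a x) = pathProd t n a * pathProd t m x := by
  rw [pathProd_add, shift_splice, pathProd_congr t (splice_mem_cyl h)]

end PathProd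

/-! ### The Markov measure -/

section Markov

variable {lam : Fin 2 → ℝ} {P : Matrix (Fin 2) (Fin 2) ℝ}

lemma pathProd_pos (hP : ∀ i, IsPosDistribution (P i)) (n : ℕ) (a : ℕ → Fin 2) :
    0 < pathProd (fun i j => P i j) n a :=
  Finset.prod_pos fun _ _ => (hP _).1 _

lemma markov_cyl (hlam : IsPosDistribution lam) (hP : ∀ i, IsPosDistribution (P i)) (n : ℕ)
    (a : ℕ → Fin 2) :
    markovMeasure lam (fun _ => P) (cyl n a) =
      ENNReal.ofReal (lam (a 0) * pathProd (fun i j => P i j) n a) :=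
  markovMeasure_cylinder hlam (fun _ => hP) n a

lemma markov_cyl_ne_zero (hlam : IsPosDistribution lam) (hP : ∀ i, IsPosDistribution (P i))
    (n : ℕ) (a : ℕ → Fin 2) : markovMeasure lam (fun _ => P) (cyl n a) ≠ 0 := by
  rw [markov_cyl hlam hP, Ne, ENNReal.ofReal_eq_zero, not_le]
  exact mul_pos (hlam.1 _) (pathProd_pos hP n a)

lemma markov_real_cyl (hlam : IsPosDistribution lam) (hP : ∀ i, IsPosDistribution (P i)) (n : ℕ)
    (a : ℕ → Fin 2) :
    (markovMeasure lam fun _ => P).real (cyl n a) = lam (a 0) * pathProd (fun i j => P i j) n a := by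
  rw [measureReal_def, markov_cyl hlam hP, ENNReal.toReal_ofReal]
  exact (mul_pos (hlam.1 _) (pathProd_pos hP n a)).le

/-- The Markov property. -/
lemma markov_cyl_inter_shift (hlam : IsPosDistribution lam) (hP : ∀ i, IsPosDistribution (P i))
    (n : ℕ) (a : ℕ → Fin 2) {B : Set (ℕ → Fin 2)} (hB : MeasurableSet B) :
    ENNReal.ofReal (lam (a n)) * markovMeasure lam (fun _ => P) (cyl n a ∩ shift n ⁻¹' B) =
      ENNReal.ofReal (lam (a 0) * pathProd (fun i j => P i j) n a) *
        markovMeasure lam (fun _ => P) ({x | x 0 = a n} ∩ B) := by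
  set μ := markovMeasure lam fun _ => P
  have key : ENNReal.ofReal (lam (a n)) • (μ.restrict (cyl n a)).map (shift n) =
      ENNReal.ofReal (lam (a 0) * pathProd (fun i j => P i j) n a) • μ.restrict {x | x 0 = a n} := by
    have : IsFiniteMeasure (ENNReal.ofReal (lam (a n)) • (μ.restrict (cyl n a)).map (shift n)) :=
      Measure.smul_finite _ ENNReal.ofReal_ne_top
    refine ext_of_cyl 0 fun k _ b => ?_
    rw [Measure.smul_apply, Measure.smul_apply,
      Measure.map_apply (measurable_shift n) (measurableSet_cyl k b),
      Measure.restrict_apply (measurable_shift n (measurableSet_cyl k b)),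
      Measure.restrict_apply (measurableSet_cyl k b), smul_eq_mul, smul_eq_mul, Set.inter_comm]
    by_cases h : b 0 = a n
    · have h2 : cyl k b ∩ {x | x 0 = a n} = cyl k b :=
        Set.inter_eq_left.2 fun x hx => (hx 0 (Nat.zero_le _)).trans h
      rw [cyl_inter_shift_cyl h, h2, markov_cyl hlam hP, markov_cyl hlam hP,
        pathProd_splice _ n k h, ← h, splice_of_le (Nat.zero_le n) h,
        ← ENNReal.ofReal_mul (hlam.1 _).le,
        ← ENNReal.ofReal_mul (mul_pos (hlam.1 _) (pathProd_pos hP n a)).le]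
      congr 1
      ring
    · have h1 : cyl n a ∩ shift n ⁻¹' cyl k b = ∅ := by
        refine Set.eq_empty_of_forall_notMem fun x hx => h ?_
        rw [← hx.1 n le_rfl, ← hx.2 0 (Nat.zero_le _), shift, zero_add]
      have h2 : cyl k b ∩ {x | x 0 = a n} = ∅ := by
        refine Set.eq_empty_of_forall_notMem fun x hx => h ?_
        rw [← hx.1 0 (Nat.zero_le _)]
        exact hx.2
      rw [h1, h2, measure_empty, mul_zero, mul_zero]
  have := congrArg (fun ν : Measure (ℕ → Fin 2) => ν B) key
  simpa only [Measure.smul_apply, Measure.map_apply (measurable_shift n) hB,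
    Measure.restrict_apply (measurable_shift n hB), Measure.restrict_apply hB, smul_eq_mul,
    Set.inter_comm] using this

lemma inter_cyl_eq (n : ℕ) (a : ℕ → Fin 2) (A : Set (ℕ → Fin 2)) :
    A ∩ cyl n a = cyl n a ∩ shift n ⁻¹' (splice n a ⁻¹' A) := by
  ext x
  simp only [Set.mem_inter_iff, Set.mem_preimage]
  constructor
  · rintro ⟨h1, h2⟩
    exact ⟨h2, by rwa [splice_shift h2]⟩
  · rintro ⟨h1, h2⟩
    rw [splice_shift h1] at h2
    exact ⟨h2, h1⟩

lemma markov_inter_cyl (hlam : IsPosDistribution lam) (hP : ∀ i, IsPosDistribution (P i))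
    (n : ℕ) (a : ℕ → Fin 2) {A : Set (ℕ → Fin 2)} (hA : MeasurableSet A) :
    ENNReal.ofReal (lam (a n)) * markovMeasure lam (fun _ => P) (A ∩ cyl n a) =
      markovMeasure lam (fun _ => P) (cyl n a) *
        markovMeasure lam (fun _ => P) {r | r 0 = a n ∧ splice n a r ∈ A} := by
  rw [inter_cyl_eq, markov_cyl_inter_shift hlam hP n a (measurable_splice n a hA),
    markov_cyl hlam hP]
  rfl

lemma ratio_eq (hlam : IsPosDistribution lam) (hP : ∀ i, IsPosDistribution (P i))
    (n : ℕ) (a : ℕ → Fin 2) {A : Set (ℕ → Fin 2)} (hA : MeasurableSet A) :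
    ratio (markovMeasure lam fun _ => P) A n a =
      (markovMeasure lam fun _ => P).real {r | r 0 = a n ∧ splice n a r ∈ A} / lam (a n) := by
  have h := congrArg ENNReal.toReal (markov_inter_cyl hlam hP n a hA)
  rw [ENNReal.toReal_mul, ENNReal.toReal_mul, ENNReal.toReal_ofReal (hlam.1 _).le] at h
  have h1 := (hlam.1 (a n)).ne'
  have h2 : (markovMeasure lam fun _ => P).real (cyl n a) ≠ 0 :=
    (measureReal_ne_zero_iff).2 (markov_cyl_ne_zero hlam hP n a)
  rw [ratio, div_eq_div_iff h2 h1, mul_comm, mul_comm _ (Measure.real _ (cyl n a))]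
  exact h

/-- Attaching a prefix maps positive sets to positive sets. -/
lemma ae_splice (hlam : IsPosDistribution lam) (hP : ∀ i, IsPosDistribution (P i))
    (n : ℕ) (a : ℕ → Fin 2) {p : (ℕ → Fin 2) → Prop}
    (hp : ∀ᵐ x ∂(markovMeasure lam fun _ => P), p x) :
    ∀ᵐ x ∂(markovMeasure lam fun _ => P), x 0 = a n → p (splice n a x) := by
  set μ := markovMeasure lam fun _ => P with hμ
  have h := markov_inter_cyl hlam hP n a (measurableSet_toMeasurable μ {x | ¬ p x})
  rw [← hμ, measure_mono_null Set.inter_subset_left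
    ((measure_toMeasurable _).trans (ae_iff.1 hp)), mul_zero, eq_comm, mul_eq_zero,
    or_iff_right (markov_cyl_ne_zero hlam hP n a)] at h
  refine ae_iff.2 (measure_mono_null (fun x hx => ?_) h)
  rw [Set.mem_ofPred_eq, Classical.not_imp] at hx
  exact ⟨hx.1, subset_toMeasurable _ _ hx.2⟩

/-- Almost every path shows every given word infinitely often. -/
lemma ae_frequently_shift_mem_cyl (hlam : IsPosDistribution lam)
    (hP : ∀ i, IsPosDistribution (P i)) (L : ℕ) (w : ℕ → Fin 2) :
    ∀ᵐ x ∂(markovMeasure lam fun _ => P), ∃ᶠ n in atTop, shift n x ∈ cyl L w := by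
  set μ := markovMeasure lam fun _ => P with hμ
  have hD : ∀ N, MeasurableSet {x : ℕ → Fin 2 | ∀ n ≥ N, shift n x ∉ cyl L w} := fun N => by
    have : {x : ℕ → Fin 2 | ∀ n ≥ N, shift n x ∉ cyl L w} =
        ⋂ n, ⋂ (_ : n ≥ N), shift n ⁻¹' (cyl L w)ᶜ := by ext x; simp
    rw [this]
    exact MeasurableSet.iInter fun n => MeasurableSet.iInter fun _ =>
      measurable_shift n (measurableSet_cyl L w).compl
  have hlevy := ae_all_iff.2 fun N => tendsto_ratio μ (markov_cyl_ne_zero hlam hP) (hD N)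
  filter_upwards [hlevy] with x hx
  rw [Filter.Frequently, eventually_atTop]
  rintro ⟨N, hN⟩
  have hx := hx N
  rw [Set.indicator_of_mem (show x ∈ {x : ℕ → Fin 2 | ∀ n ≥ N, shift n x ∉ cyl L w} from hN)]
    at hx
  obtain ⟨δ, hδ, hδP⟩ : ∃ δ : ℝ, 0 < δ ∧ ∀ s, δ ≤ P s (w 0) * pathProd (fun i j => P i j) L w := by
    have h : ∀ s, 0 < P s (w 0) * pathProd (fun i j => P i j) L w :=
      fun s => mul_pos ((hP s).1 _) (pathProd_pos hP L w)
    refine ⟨min (P 0 (w 0) * pathProd (fun i j => P i j) L w)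
      (P 1 (w 0) * pathProd (fun i j => P i j) L w),
      lt_min (h 0) (h 1), fun s => ?_⟩
    fin_cases s
    · exact min_le_left _ _
    · exact min_le_right _ _
  have hle : ∀ n ≥ N, ratio μ {x | ∀ n ≥ N, shift n x ∉ cyl L w} n x ≤ 1 - δ := by
    intro n hn
    have hpos : 0 < μ.real (cyl n x) := by
      rw [hμ, markov_real_cyl hlam hP]
      exact mul_pos (hlam.1 _) (pathProd_pos hP n x)
    set y := splice (n + 1) x w with hy
    have hyx : y ∈ cyl n x := fun i hi => splice_of_lt (Nat.lt_succ_of_le hi) _ _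
    have hys : shift (n + 1) y = w := shift_splice _ _ _
    have hsub : cyl (n + 1 + L) y ⊆ cyl n x := by
      rw [← cyl_eq_of_mem hyx]
      exact cyl_anti (by omega) y
    have hval : δ * μ.real (cyl n x) ≤ μ.real (cyl (n + 1 + L) y) := by
      have h1 : pathProd (fun i j => P i j) 1 (shift n y) = P (x n) (w 0) := by
        simp only [pathProd, Finset.prod_range_one, shift, zero_add]
        rw [hyx n le_rfl, add_comm 1 n]
        congr 1
        exact splice_add (n + 1) 0 x w
      rw [hμ, markov_real_cyl hlam hP, markov_real_cyl hlam hP, pathProd_add, hys, pathProd_add,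
        pathProd_congr _ hyx, h1, hyx 0 (Nat.zero_le _)]
      have := mul_le_mul_of_nonneg_left (hδP (x n))
        (mul_pos (hlam.1 (x 0)) (pathProd_pos hP n x)).le
      linarith
    have hle2 : μ.real ({x | ∀ n ≥ N, shift n x ∉ cyl L w} ∩ cyl n x) ≤
        μ.real (cyl n x) - μ.real (cyl (n + 1 + L) y) := by
      rw [← measureReal_sdiff hsub (measurableSet_cyl _ _)]
      refine measureReal_mono ?_
      rintro z ⟨hz1, hz2⟩
      refine ⟨hz2, fun hz => hz1 (n + 1) (by omega) fun i hi => ?_⟩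
      rw [← congrFun hys i, shift, shift, hz _ (by omega)]
    rw [ratio, div_le_iff₀ hpos]
    linarith
  have := le_of_tendsto hx (eventually_atTop.2 ⟨N, hle⟩)
  linarith

end Markov

/-! ### The zero-one law for sets that depend on the path through the tail and the path product -/

section ZeroOne

variable {lam : Fin 2 → ℝ} {P : Matrix (Fin 2) (Fin 2) ℝ} {H : Type*}

/-- `A` does not distinguish sequences with the same tail and the same product over the
transitions before that tail. -/
def IsExchangeable [CommMonoid H] (t : Fin 2 → Fin 2 → H) (A : Set (ℕ → Fin 2)) : Prop :=
  ∀ n x y, (∀ i, n ≤ i → x i = y i) → pathProd t n x = pathProd t n y → (x ∈ A ↔ y ∈ A)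

lemma IsExchangeable.splice_mem_iff [CommMonoid H] {t : Fin 2 → Fin 2 → H}
    {A : Set (ℕ → Fin 2)} (hA : IsExchangeable t A) {n : ℕ} {a b r : ℕ → Fin 2}
    (hab : a n = b n) (ht : pathProd t n a = pathProd t n b) (hr : r 0 = a n) :
    splice n a r ∈ A ↔ splice n b r ∈ A := by
  refine hA n _ _ (fun i hi => ?_) ?_
  · obtain ⟨j, rfl⟩ := Nat.exists_eq_add_of_le hi
    rw [splice_add, splice_add]
  · rw [pathProd_congr t (splice_mem_cyl hr), pathProd_congr t (splice_mem_cyl (hr.trans hab)), ht]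

lemma IsExchangeable.ratio_eq [CommMonoid H] (hlam : IsPosDistribution lam)
    (hP : ∀ i, IsPosDistribution (P i)) {t : Fin 2 → Fin 2 → H} {A : Set (ℕ → Fin 2)}
    (hA : IsExchangeable t A) (hAm : MeasurableSet A) {n : ℕ} {a b : ℕ → Fin 2}
    (hab : a n = b n) (ht : pathProd t n a = pathProd t n b) :
    ratio (markovMeasure lam fun _ => P) A n a = ratio (markovMeasure lam fun _ => P) A n b := by
  rw [OrbitType.ratio_eq hlam hP n a hAm, OrbitType.ratio_eq hlam hP n b hAm, ← hab]
  congr 2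
  ext r
  exact and_congr_right fun hr => hA.splice_mem_iff hab ht hr

/-- Attaching a loop at `0` in front does not change the membership in an exchangeable set. -/
lemma IsExchangeable.ae_splice_loop [CommMonoid H] (hlam : IsPosDistribution lam)
    (hP : ∀ i, IsPosDistribution (P i)) {t : Fin 2 → Fin 2 → H} {A : Set (ℕ → Fin 2)}
    (hA : IsExchangeable t A) (hAm : MeasurableSet A) {L : ℕ} {w : ℕ → Fin 2}
    (h0 : w 0 = 0) (hL : w L = 0) :
    ∀ᵐ x ∂(markovMeasure lam fun _ => P), x 0 = 0 → (splice L w x ∈ A ↔ x ∈ A) := by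
  have hlevy := tendsto_ratio (markovMeasure lam fun _ => P) (markov_cyl_ne_zero hlam hP) hAm
  filter_upwards [hlevy, ae_splice hlam hP L w hlevy, ae_frequently_shift_mem_cyl hlam hP L w]
    with x hx1 hx2 hx3 hx0
  have hxw : x 0 = w L := hx0.trans hL.symm
  have hx2 := hx2 hxw
  have hfreq : ∃ᶠ n in atTop, ratio (markovMeasure lam fun _ => P) A (L + n) (splice L w x) -
      ratio (markovMeasure lam fun _ => P) A (L + n) x = 0 := by
    refine hx3.mono fun n hn => sub_eq_zero.2 (hA.ratio_eq hlam hP hAm ?_ ?_)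
    · have h1 := hn 0 (Nat.zero_le _)
      have h2 := hn L le_rfl
      rw [shift, zero_add] at h1
      rw [shift] at h2
      rw [splice_add, h1, h2, h0, hL]
    · rw [pathProd_splice t L n hxw, add_comm L n, pathProd_add, pathProd_congr t hn, mul_comm]
  have hshift : Tendsto (fun n => L + n) atTop atTop :=
    tendsto_atTop_mono (fun n => Nat.le_add_left n L) tendsto_id
  have hlim := (hx2.comp hshift).sub (hx1.comp hshift)
  have heq := isClosed_singleton.mem_of_frequently_of_tendsto
    (hfreq.mono fun n hn => Set.mem_singleton_iff.2 hn) hlim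
  rw [Set.mem_singleton_iff, sub_eq_zero] at heq
  by_cases h1 : splice L w x ∈ A <;> by_cases h2 : x ∈ A <;> simp_all

/-- The zero-one law for exchangeable sets. -/
theorem IsExchangeable.null_or_conull [CommMonoid H] (hlam : IsPosDistribution lam)
    (hP : ∀ i, IsPosDistribution (P i)) {t : Fin 2 → Fin 2 → H} (ht : t 0 0 = t 0 1)
    {A : Set (ℕ → Fin 2)} (hA : IsExchangeable t A) (hAm : MeasurableSet A) :
    markovMeasure lam (fun _ => P) A = 0 ∨ markovMeasure lam (fun _ => P) Aᶜ = 0 := by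
  set μ := markovMeasure lam fun _ => P with hμ
  set p : ℝ := μ.real {r | r 0 = 0 ∧ r ∈ A} / lam 0
  have hloop : ∀ L w, w 0 = 0 → w L = 0 → ratio μ A L w = p := by
    intro L w h0 hL
    rw [hμ, OrbitType.ratio_eq hlam hP L w hAm, hL]
    congr 1
    refine measureReal_congr ?_
    filter_upwards [hA.ae_splice_loop hlam hP hAm h0 hL] with x hx
    exact propext (and_congr_right hx)
  have hdouble : ∀ n x, x n = 0 → x (n + 1) = 0 → ratio μ A (n + 1) x = p := by
    intro n x h1 h2
    rw [← hloop (n + 1) (splice 1 (fun _ => 0) x) (splice_of_lt one_pos _ _)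
      (by rw [add_comm, splice_add, h1])]
    refine hA.ratio_eq hlam hP hAm ?_ ?_
    · rw [add_comm n 1, splice_add, h1, add_comm, h2]
    · rw [pathProd_add, add_comm n 1, pathProd_add, shift_splice, mul_comm]
      congr 1
      have h3 : splice 1 (fun _ => 0) x 0 = 0 := splice_of_lt one_pos _ _
      have h4 : splice 1 (fun _ => 0) x 1 = x 0 := splice_add 1 0 _ x
      simp only [pathProd, Finset.prod_range_one, shift, zero_add, add_comm 1 n, h1, h2, h3, h4]
      rcases (by omega : x 0 = 0 ∨ x 0 = 1) with h | h
      · rw [h]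
      · rw [h, ht]
  have hae : ∀ᵐ x ∂μ, A.indicator (fun _ => (1 : ℝ)) x = p := by
    filter_upwards [tendsto_ratio μ (markov_cyl_ne_zero hlam hP) hAm,
      ae_frequently_shift_mem_cyl hlam hP 1 fun _ => 0] with x hx1 hx2
    refine Set.mem_singleton_iff.1 (isClosed_singleton.mem_of_frequently_of_tendsto
      (hx2.mono fun n hn => Set.mem_singleton_iff.2 (hdouble n x ?_ ?_))
      (hx1.comp (tendsto_add_atTop_nat 1)))
    · simpa [shift] using hn 0 (by omega)
    · simpa [shift, add_comm] using hn 1 le_rfl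
  by_cases hp : p = 1
  · right
    refine measure_mono_null (fun x hx => Set.mem_ofPred_eq ▸ fun hxp => ?_) (ae_iff.1 hae)
    rw [Set.indicator_of_notMem hx, hp] at hxp
    exact zero_ne_one hxp
  · left
    refine measure_mono_null (fun x hx => Set.mem_ofPred_eq ▸ fun hxp => ?_) (ae_iff.1 hae)
    rw [Set.indicator_of_mem hx] at hxp
    exact hp hxp.symm

end ZeroOne

/-! ### Cocycles of the tail relation given by path products -/

section TailCocycle

variable {G : Type*} [CommGroup G]

/-- A coordinate from which on `x` and `y` agree (the first one, if `x` and `y` have the same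
tail). -/
def agreeIndex (x y : ℕ → Fin 2) : ℕ := sInf {N | ∀ i, N ≤ i → x i = y i}

lemma eq_of_agreeIndex_le {x y : ℕ → Fin 2} (h : tailRel (Fin 2) x y) {i : ℕ}
    (hi : agreeIndex x y ≤ i) : x i = y i :=
  Nat.sInf_mem (s := {N | ∀ i, N ≤ i → x i = y i}) h i hi

/-- A path product, with a weight for the initial letter. -/
def wordWeight (t₀ : Fin 2 → G) (t : Fin 2 → Fin 2 → G) (n : ℕ) (x : ℕ → Fin 2) : G :=
  t₀ (x 0) * pathProd t n x

/-- The cocycle of the tail relation that compares the weights of initial words. -/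
def tailCocycle (t₀ : Fin 2 → G) (t : Fin 2 → Fin 2 → G) (x y : ℕ → Fin 2) : G :=
  wordWeight t₀ t (agreeIndex x y) y / wordWeight t₀ t (agreeIndex x y) x

variable {t₀ : Fin 2 → G} {t : Fin 2 → Fin 2 → G}

lemma wordWeight_congr {n : ℕ} {x y : ℕ → Fin 2} (h : x ∈ cyl n y) :
    wordWeight t₀ t n x = wordWeight t₀ t n y := by
  rw [wordWeight, wordWeight, pathProd_congr t h, h 0 (Nat.zero_le _)]

lemma tailCocycle_eq {n : ℕ} {x y : ℕ → Fin 2} (h : ∀ i, n ≤ i → x i = y i) :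
    tailCocycle t₀ t x y = wordWeight t₀ t n y / wordWeight t₀ t n x := by
  have hle : agreeIndex x y ≤ n := Nat.sInf_le h
  obtain ⟨m, hm⟩ := Nat.exists_eq_add_of_le hle
  have hs : shift (agreeIndex x y) x = shift (agreeIndex x y) y :=
    funext fun i => eq_of_agreeIndex_le ⟨n, h⟩ (Nat.le_add_left _ i)
  rw [tailCocycle, wordWeight, wordWeight, wordWeight, wordWeight, hm, pathProd_add, pathProd_add,
    hs, ← mul_assoc, ← mul_assoc, mul_div_mul_right_eq_div]

lemma measurable_agreeIndex :
    Measurable fun p : {p : (ℕ → Fin 2) × (ℕ → Fin 2) // tailRel (Fin 2) p.1 p.2} =>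
      agreeIndex p.1.1 p.1.2 := by
  refine measurable_of_Iic fun k => ?_
  have : (fun p : {p : (ℕ → Fin 2) × (ℕ → Fin 2) // tailRel (Fin 2) p.1 p.2} =>
      agreeIndex p.1.1 p.1.2) ⁻¹' Set.Iic k =
      ⋂ i, ⋂ (_ : k ≤ i), {p | p.1.1 i = p.1.2 i} := by
    ext p
    simp only [Set.mem_preimage, Set.mem_Iic, Set.mem_iInter, Set.mem_ofPred_eq]
    exact ⟨fun h i hi => eq_of_agreeIndex_le p.2 (h.trans hi), fun h => Nat.sInf_le h⟩
  rw [this]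
  refine MeasurableSet.iInter fun i => MeasurableSet.iInter fun _ => ?_
  exact measurableSet_eq_fun
    ((measurable_pi_apply i).comp (measurable_fst.comp measurable_subtype_coe))
    ((measurable_pi_apply i).comp (measurable_snd.comp measurable_subtype_coe))

lemma measurable_tailCocycle [MeasurableSpace G] :
    Measurable fun p : {p : (ℕ → Fin 2) × (ℕ → Fin 2) // tailRel (Fin 2) p.1 p.2} =>
      tailCocycle t₀ t p.1.1 p.1.2 := by
  have h1 : ∀ n, Measurable fun p : (ℕ → Fin 2) × (ℕ → Fin 2) =>
      wordWeight t₀ t n p.2 / wordWeight t₀ t n p.1 := by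
    intro n
    have h2 : (fun p : (ℕ → Fin 2) × (ℕ → Fin 2) =>
        wordWeight t₀ t n p.2 / wordWeight t₀ t n p.1) =
        (fun w : (Fin (n + 1) → Fin 2) × (Fin (n + 1) → Fin 2) =>
          wordWeight t₀ t n (extendWord w.2) / wordWeight t₀ t n (extendWord w.1)) ∘
        fun p => (fun i => p.1 i, fun i => p.2 i) :=
      funext fun p => congrArg₂ (· / ·) (wordWeight_congr (mem_cyl_extendWord n p.2))
        (wordWeight_congr (mem_cyl_extendWord n p.1))
    rw [h2]
    refine (measurable_of_countable _).comp (Measurable.prodMk ?_ ?_)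
    · exact measurable_pi_lambda _ fun i => (measurable_pi_apply (i : ℕ)).comp measurable_fst
    · exact measurable_pi_lambda _ fun i => (measurable_pi_apply (i : ℕ)).comp measurable_snd
  have h3 : Measurable fun q : ℕ × ((ℕ → Fin 2) × (ℕ → Fin 2)) =>
      wordWeight t₀ t q.1 q.2.2 / wordWeight t₀ t q.1 q.2.1 :=
    measurable_from_prod_countable_right h1
  exact h3.comp (measurable_agreeIndex.prodMk measurable_subtype_coe)

lemma tailCocycle_mul {x y z : ℕ → Fin 2} (hxy : tailRel (Fin 2) x y)
    (hyz : tailRel (Fin 2) y z) :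
    tailCocycle t₀ t x y * tailCocycle t₀ t y z = tailCocycle t₀ t x z := by
  obtain ⟨N, hN⟩ := hxy
  obtain ⟨M, hM⟩ := hyz
  have h1 : ∀ i, max N M ≤ i → x i = y i := fun i hi => hN i (le_of_max_le_left hi)
  have h2 : ∀ i, max N M ≤ i → y i = z i := fun i hi => hM i (le_of_max_le_right hi)
  rw [tailCocycle_eq h1, tailCocycle_eq h2,
    tailCocycle_eq fun i hi => (h1 i hi).trans (h2 i hi), mul_comm, div_mul_div_cancel]

lemma isCocycle_tailCocycle [MeasurableSpace G] (μ : Measure (ℕ → Fin 2)) :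
    IsCocycle (tailRel (Fin 2)) μ (tailCocycle t₀ t) where
  measurable := measurable_tailCocycle
  mul_eq := ⟨Set.univ, MeasurableSet.univ, by simp,
    fun _ _ _ _ _ _ hxy hyz => tailCocycle_mul hxy hyz⟩

end TailCocycle

/-! ### The group of finite changes of coordinates -/

/-- The group of the translations of `(ℤ/2)^ℕ` by finitely supported elements. -/
def finiteTranslations : Subgroup (Equiv.Perm (ℕ → Fin 2)) where
  carrier := Set.range fun s : ℕ →₀ Fin 2 => Equiv.addLeft (s : ℕ → Fin 2)
  mul_mem' := by
    rintro _ _ ⟨s, rfl⟩ ⟨u, rfl⟩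
    exact ⟨s + u, Equiv.ext fun x => by simp⟩
  one_mem' := ⟨0, Equiv.ext fun x => by simp⟩
  inv_mem' := by
    rintro _ ⟨s, rfl⟩
    exact ⟨-s, eq_inv_of_mul_eq_one_left (Equiv.ext fun x => by simp)⟩

lemma measurable_addLeft (s : ℕ → Fin 2) : Measurable fun x : ℕ → Fin 2 => s + x :=
  measurable_pi_lambda _ fun i =>
    (measurable_of_countable fun b : Fin 2 => s i + b).comp (measurable_pi_apply i)

lemma tailRel_iff_exists_add {x y : ℕ → Fin 2} :
    tailRel (Fin 2) x y ↔ ∃ s : ℕ →₀ Fin 2, (s : ℕ → Fin 2) + x = y := by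
  constructor
  · rintro ⟨N, hN⟩
    refine ⟨Finsupp.ofSupportFinite (y - x) ((Set.finite_Iio N).subset fun i hi => ?_), ?_⟩
    · by_contra h
      exact hi (by simp [hN i (not_lt.1 h)])
    · rw [Finsupp.ofSupportFinite_coe, sub_add_cancel]
  · rintro ⟨s, rfl⟩
    refine ⟨s.support.sup id + 1, fun i hi => ?_⟩
    have : s i = 0 := by
      by_contra h
      have := Finset.le_sup (f := id) (Finsupp.mem_support_iff.2 h)
      simp only [id] at this
      omega
    simp [this]

lemma generates_finiteTranslations : Generates finiteTranslations (tailRel (Fin 2)) where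
  countable := (Set.countable_range _).to_subtype
  measurable := by
    rintro _ ⟨s, rfl⟩
    exact measurable_addLeft s
  rel_iff x y := by
    rw [tailRel_iff_exists_add]
    constructor
    · rintro ⟨s, h⟩
      exact ⟨_, ⟨s, rfl⟩, h⟩
    · rintro ⟨_, ⟨s, rfl⟩, h⟩
      exact ⟨s, h⟩

lemma isCountableBorel_tailRel : IsCountableBorel (tailRel (Fin 2)) where
  measurableSet := by
    have : {p : (ℕ → Fin 2) × (ℕ → Fin 2) | tailRel (Fin 2) p.1 p.2} =
        ⋃ N : ℕ, ⋂ i, ⋂ (_ : N ≤ i), {p | p.1 i = p.2 i} := by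
      ext p
      simp only [Set.mem_iUnion, Set.mem_iInter, Set.mem_ofPred_eq]
      rfl
    rw [this]
    refine MeasurableSet.iUnion fun N => MeasurableSet.iInter fun i =>
      MeasurableSet.iInter fun _ => ?_
    exact measurableSet_eq_fun ((measurable_pi_apply i).comp measurable_fst)
      ((measurable_pi_apply i).comp measurable_snd)
  countable_class x := by
    refine (Set.countable_range fun s : ℕ →₀ Fin 2 => (s : ℕ → Fin 2) + x).mono fun y hy => ?_
    exact tailRel_iff_exists_add.1 hy

lemma preimage_add_cyl (s : ℕ → Fin 2) (k : ℕ) (a : ℕ → Fin 2) :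
    (fun x => s + x) ⁻¹' cyl k a = cyl k (-s + a) := by
  ext x
  refine forall₂_congr fun i _ => ?_
  simp only [Pi.add_apply, Pi.neg_apply]
  rw [eq_neg_add_iff_add_eq]

/-! ### The Radon-Nikodym cocycle of the Markov measure -/

section RadonNikodym

variable {lam : Fin 2 → ℝ} {P : Matrix (Fin 2) (Fin 2) ℝ}

/-- The measure of the cylinder of the first `n + 1` letters, as a positive real. -/
def markovWeight (hlam : IsPosDistribution lam) (hP : ∀ i, IsPosDistribution (P i)) (n : ℕ)
    (x : ℕ → Fin 2) : PosReal :=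
  wordWeight (fun i => (⟨lam i, hlam.1 i⟩ : PosReal)) (fun i j => ⟨P i j, (hP i).1 j⟩) n x

/-- The Radon-Nikodym cocycle of the tail relation and a Markov measure. -/
def markovCocycle (hlam : IsPosDistribution lam) (hP : ∀ i, IsPosDistribution (P i)) :
    (ℕ → Fin 2) → (ℕ → Fin 2) → PosReal :=
  tailCocycle (fun i => ⟨lam i, hlam.1 i⟩) fun i j => ⟨P i j, (hP i).1 j⟩

lemma coe_markovWeight (hlam : IsPosDistribution lam) (hP : ∀ i, IsPosDistribution (P i)) (n : ℕ)
    (x : ℕ → Fin 2) :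
    (markovWeight hlam hP n x : ℝ) = lam (x 0) * pathProd (fun i j => P i j) n x := by
  rw [markovWeight, wordWeight, Positive.val_mul]
  congr 1
  rw [pathProd, pathProd]
  induction n with
  | zero => simp
  | succ n ih => rw [Finset.prod_range_succ, Finset.prod_range_succ, Positive.val_mul, ih]

lemma measurable_markovCocycle (hlam : IsPosDistribution lam)
    (hP : ∀ i, IsPosDistribution (P i)) (s : ℕ →₀ Fin 2) :
    Measurable fun x => ENNReal.ofReal (markovCocycle hlam hP x ((s : ℕ → Fin 2) + x)) := by
  have h : Measurable fun x : ℕ → Fin 2 =>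
      (⟨(x, (s : ℕ → Fin 2) + x), tailRel_iff_exists_add.2 ⟨s, rfl⟩⟩ :
        {p : (ℕ → Fin 2) × (ℕ → Fin 2) // tailRel (Fin 2) p.1 p.2}) :=
    (measurable_id.prodMk (measurable_addLeft s)).subtype_mk
  exact (measurable_subtype_coe.comp (measurable_tailCocycle.comp h)).ennreal_ofReal

lemma markov_map_neg_add (hlam : IsPosDistribution lam) (hP : ∀ i, IsPosDistribution (P i))
    (s : ℕ →₀ Fin 2) :
    (markovMeasure lam fun _ => P).map (fun x => -(s : ℕ → Fin 2) + x) =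
      (markovMeasure lam fun _ => P).withDensity fun x =>
        ENNReal.ofReal (markovCocycle hlam hP x ((s : ℕ → Fin 2) + x)) := by
  have : IsFiniteMeasure ((markovMeasure lam fun _ => P).map fun x => -(s : ℕ → Fin 2) + x) :=
    Measure.isFiniteMeasure_map _ _
  obtain ⟨N, hN⟩ : ∃ N, ∀ i, N ≤ i → s i = 0 := by
    obtain ⟨N, hN⟩ := tailRel_iff_exists_add.2
      (⟨s, rfl⟩ : ∃ u : ℕ →₀ Fin 2, (u : ℕ → Fin 2) + 0 = _)
    exact ⟨N, fun i hi => by simpa using (hN i hi).symm⟩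
  refine ext_of_cyl N fun k hk a => ?_
  have hval : ∀ x ∈ cyl k a, markovCocycle hlam hP x ((s : ℕ → Fin 2) + x) =
      markovWeight hlam hP k ((s : ℕ → Fin 2) + a) / markovWeight hlam hP k a := by
    intro x hx
    rw [markovCocycle, tailCocycle_eq (n := k) fun i hi => by simp [hN i (hk.trans hi)]]
    congr 1
    · exact wordWeight_congr fun i hi => by simp [hx i hi]
    · exact wordWeight_congr hx
  have hnn := (markovWeight hlam hP k ((s : ℕ → Fin 2) + a) / markovWeight hlam hP k a).2.le
  rw [Measure.map_apply (measurable_addLeft _) (measurableSet_cyl k a), preimage_add_cyl, neg_neg,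
    withDensity_apply _ (measurableSet_cyl k a),
    setLIntegral_congr_fun (measurableSet_cyl k a) fun x hx => by rw [hval x hx],
    setLIntegral_const, markov_cyl hlam hP, markov_cyl hlam hP, ← coe_markovWeight hlam hP,
    ← coe_markovWeight hlam hP, ← ENNReal.ofReal_mul hnn, ← Positive.val_mul,
    div_mul_cancel]

lemma isRadonNikodymCocycle_markovCocycle (hlam : IsPosDistribution lam)
    (hP : ∀ i, IsPosDistribution (P i)) :
    IsRadonNikodymCocycle (tailRel (Fin 2)) (markovMeasure lam fun _ => P)
      (markovCocycle hlam hP) where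
  isCocycle := isCocycle_tailCocycle _
  eq_rnDeriv := by
    refine ⟨finiteTranslations, generates_finiteTranslations, ?_⟩
    rintro _ ⟨s, rfl⟩
    have h : (markovMeasure lam fun _ => P).map
        ((Equiv.addLeft (s : ℕ → Fin 2))⁻¹ : Equiv.Perm (ℕ → Fin 2)) =
        (markovMeasure lam fun _ => P).map fun x => -(s : ℕ → Fin 2) + x := by
      rfl
    rw [h, markov_map_neg_add hlam hP]
    exact (Measure.rnDeriv_withDensity _ (measurable_markovCocycle hlam hP s)).symm

lemma isNonsingular_markov (hlam : IsPosDistribution lam) (hP : ∀ i, IsPosDistribution (P i)) :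
    IsNonsingular (tailRel (Fin 2)) (markovMeasure lam fun _ => P) := by
  intro A hA h0
  have hsub : {y | ∃ x ∈ A, tailRel (Fin 2) x y} ⊆
      ⋃ s : ℕ →₀ Fin 2, (fun x => -(s : ℕ → Fin 2) + x) ⁻¹' A := by
    rintro y ⟨x, hx, hxy⟩
    obtain ⟨s, rfl⟩ := tailRel_iff_exists_add.1 hxy
    exact Set.mem_iUnion.2 ⟨s, by simpa using hx⟩
  refine measure_mono_null hsub (measure_iUnion_null fun s => ?_)
  rw [← Measure.map_apply (measurable_addLeft _) hA, markov_map_neg_add hlam hP]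
  exact withDensity_absolutelyContinuous _ _ h0

lemma markov_singleton (hlam : IsPosDistribution lam) (hP : ∀ i, IsPosDistribution (P i))
    (x : ℕ → Fin 2) : markovMeasure lam (fun _ => P) {x} = 0 := by
  obtain ⟨q, hq0, hq1, hq⟩ : ∃ q : ℝ, 0 ≤ q ∧ q < 1 ∧ ∀ i j, P i j ≤ q := by
    have hlt : ∀ i j, P i j < 1 := by
      intro i j
      have h0 := (hP i).1 0
      have h1 := (hP i).1 1
      have h2 := (hP i).2
      fin_cases j <;> simp only [Fin.mk_one, Fin.zero_eta] <;> linarith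
    refine ⟨max (max (P 0 0) (P 0 1)) (max (P 1 0) (P 1 1)), ?_, ?_, ?_⟩
    · exact ((hP 0).1 0).le.trans ((le_max_left _ _).trans (le_max_left _ _))
    · simp [hlt]
    · intro i j
      fin_cases i <;> fin_cases j <;> simp
  have hle : ∀ n, markovMeasure lam (fun _ => P) {x} ≤ ENNReal.ofReal (lam (x 0) * q ^ n) := by
    intro n
    refine (measure_mono (Set.singleton_subset_iff.2 (mem_cyl_self n x))).trans ?_
    rw [markov_cyl hlam hP]
    refine ENNReal.ofReal_le_ofReal (mul_le_mul_of_nonneg_left ?_ (hlam.1 _).le)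
    refine (Finset.prod_le_prod (fun i _ => ((hP _).1 _).le) fun i _ => hq _ _).trans ?_
    simp
  have hlim : Tendsto (fun n => ENNReal.ofReal (lam (x 0) * q ^ n)) atTop (𝓝 0) := by
    have := ENNReal.tendsto_ofReal
      ((tendsto_pow_atTop_nhds_zero_of_lt_one hq0 hq1).const_mul (lam (x 0)))
    simpa using this
  exact le_antisymm (ge_of_tendsto' hlim hle) zero_le

lemma isErgodicRel_markov (hlam : IsPosDistribution lam) (hP : ∀ i, IsPosDistribution (P i)) :
    IsErgodicRel (tailRel (Fin 2)) (markovMeasure lam fun _ => P) := by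
  intro A hA hinv
  have h : IsExchangeable (fun _ _ => (1 : ℕ)) A := fun n x y h _ => hinv x y ⟨n, h⟩
  exact h.null_or_conull hlam hP rfl hA

lemma isErgodicNonsingular_markov (hlam : IsPosDistribution lam)
    (hP : ∀ i, IsPosDistribution (P i)) :
    IsErgodicNonsingular (tailRel (Fin 2)) (markovMeasure lam fun _ => P) where
  countableBorel := isCountableBorel_tailRel
  nonsingular := isNonsingular_markov hlam hP
  noAtoms := markov_singleton hlam hP
  ergodic := isErgodicRel_markov hlam hP

end RadonNikodym
open scoped symmDiff Pointwise

/-! ### Ergodicity of the translations by a dense set -/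

section Dense

variable {G : Type*} [Group G] [TopologicalSpace G] [IsTopologicalGroup G] [LocallyCompactSpace G]
  [SecondCountableTopology G] [MeasurableSpace G] [BorelSpace G]

/-- A measurable set that is invariant under the translations by the elements of a dense set is
null or conull for Haar measure. -/
lemma null_or_conull_of_dense (ν : Measure G) [ν.IsHaarMeasure] {D E : Set G} (hD : Dense D)
    (hE : MeasurableSet E) (hinv : ∀ γ ∈ D, ∀ g, g ∈ E ↔ γ * g ∈ E) : ν E = 0 ∨ ν Eᶜ = 0 := by
  have hdiff : ∀ z : G, ν ((z * ·) ⁻¹' E \ E) = 0 := by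
    intro z
    have hn : ∀ n, ν ((z * ·) ⁻¹' (E ∩ spanningSets ν n) \ E) = 0 := by
      intro n
      have hs : MeasurableSet (E ∩ spanningSets ν n) := hE.inter (measurableSet_spanningSets ν n)
      have hfin : ν (E ∩ spanningSets ν n) ≠ ⊤ :=
        measure_ne_top_of_subset Set.inter_subset_right (measure_spanningSets_lt_top ν n).ne
      let f : C(G × G, G) := ⟨fun p => p.1 * p.2, continuous_mul⟩
      have hlim := tendsto_measure_symmDiff_preimage_nhds_zero (μ := ν) (ν := ν)
        (f.curry.continuous.tendsto z)
        (Eventually.of_forall fun w => measurePreserving_mul_left ν w)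
        (measurePreserving_mul_left ν z) hs.nullMeasurableSet hfin
      refine le_antisymm (ge_of_tendsto_of_frequently hlim ?_) zero_le
      refine (mem_closure_iff_frequently.1 (hD z)).mono fun w hw => measure_mono ?_
      rintro g ⟨hg1, hg2⟩
      exact Or.inr ⟨hg1, fun hg3 => hg2 ((hinv w hw g).2 hg3.1)⟩
    refine measure_mono_null ?_ (measure_iUnion_null hn)
    rintro g ⟨hg1, hg2⟩
    have : z * g ∈ ⋃ n, spanningSets ν n := by rw [iUnion_spanningSets]; trivial
    obtain ⟨n, hn⟩ := Set.mem_iUnion.1 this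
    exact Set.mem_iUnion.2 ⟨n, ⟨hg1, hn⟩, hg2⟩
  have hae : ∀ z : G, (z • ·) ⁻¹' E =ᵐ[ν] E := by
    intro z
    refine (ae_le_set.2 (hdiff z)).antisymm (ae_le_set.2 ?_)
    rw [← (measurePreserving_mul_left ν z⁻¹).measure_preimage
      (hE.diff (measurable_const_mul z hE)).nullMeasurableSet]
    convert hdiff z⁻¹ using 2
    ext g
    simp
  have := aeconst_of_forall_preimage_smul_ae_eq G hE.nullMeasurableSet hae
  rw [eventuallyConst_set] at this
  rcases this with h | h
  · exact Or.inr h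
  · exact Or.inl (by simpa [ae_iff] using h)

end Dense

/-! ### The positive reals -/

instance : IsTopologicalGroup PosReal where
  continuous_mul := ((continuous_subtype_val.comp continuous_fst).mul
    (continuous_subtype_val.comp continuous_snd)).subtype_mk _
  continuous_inv := (continuous_subtype_val.inv₀ fun x : PosReal => x.2.ne').subtype_mk _

instance : LocallyCompactSpace PosReal := (isOpen_Ioi (a := (0 : ℝ))).locallyCompactSpace

lemma discreteTopology_zpowers {l : PosReal} (hl : l < 1) :
    DiscreteTopology (Subgroup.zpowers l) := by
  refine discreteTopology_of_isOpen_singleton_one ?_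
  have hl' : (l : ℝ) < 1 := hl
  have : ({1} : Set (Subgroup.zpowers l)) =
      (fun x : Subgroup.zpowers l => ((x : PosReal) : ℝ)) ⁻¹' Set.Ioo (l : ℝ) (l : ℝ)⁻¹ := by
    ext ⟨x, n, rfl⟩
    simp only [Set.mem_singleton_iff, Set.mem_preimage, Set.mem_Ioo, Positive.coe_zpow]
    constructor
    · intro h
      have h1 : l ^ n = 1 := congrArg Subtype.val h
      have h2 : ((l : ℝ)) ^ n = 1 := congrArg Subtype.val h1
      rw [h2]
      exact ⟨hl', (one_lt_inv₀ l.2).2 hl'⟩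
    · rintro ⟨h1, h2⟩
      have h1 : (l : ℝ) ^ (1 : ℤ) < (l : ℝ) ^ n := by rwa [zpow_one]
      have h2 : (l : ℝ) ^ n < (l : ℝ) ^ (-1 : ℤ) := by rwa [zpow_neg_one]
      rw [zpow_lt_zpow_iff_right_of_lt_one₀ l.2 hl'] at h1 h2
      obtain rfl : n = 0 := by omega
      exact Subtype.ext (zpow_zero l)
  rw [this]
  exact isOpen_Ioo.preimage (continuous_subtype_val.comp continuous_subtype_val)

/-! ### Ergodicity of skew products -/

section Skew

variable {lam : Fin 2 → ℝ} {P : Matrix (Fin 2) (Fin 2) ℝ} {G : Type*} [CommGroup G]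
  {t : Fin 2 → Fin 2 → G} {A : Set ((ℕ → Fin 2) × G)}

lemma tailCocycle_one_eq {n : ℕ} {x y : ℕ → Fin 2} (h : ∀ i, n ≤ i → x i = y i) :
    tailCocycle 1 t x y = pathProd t n y / pathProd t n x := by
  simp [tailCocycle_eq h, wordWeight]

lemma isExchangeable_slice
    (hA : ∀ p q, SkewProduct (tailRel (Fin 2)) (tailCocycle 1 t) p q → (p ∈ A ↔ q ∈ A)) (g : G) :
    IsExchangeable t {x | (x, g) ∈ A} := by
  intro n x y h ht
  exact hA (x, g) (y, g) ⟨⟨n, h⟩, by rw [tailCocycle_one_eq h, ht, div_self', one_mul]⟩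

/-- The set of the `g` with null slices is invariant under the quotients of the path products of
words of the same length with the same last letter. -/
lemma slice_null_of_slice_null [MeasurableSpace G] (hlam : IsPosDistribution lam)
    (hP : ∀ i, IsPosDistribution (P i)) (ht : t 0 0 = t 0 1) (hAm : MeasurableSet A)
    (hA : ∀ p q, SkewProduct (tailRel (Fin 2)) (tailCocycle 1 t) p q → (p ∈ A ↔ q ∈ A))
    {n : ℕ} {v w : ℕ → Fin 2} (hvw : v n = w n) {g h : G}
    (hgh : h = pathProd t n w / pathProd t n v * g)
    (hg : markovMeasure lam (fun _ => P) {x | (x, g) ∈ A} = 0) :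
    markovMeasure lam (fun _ => P) {x | (x, h) ∈ A} = 0 := by
  set μ := markovMeasure lam fun _ => P with hμ
  refine ((isExchangeable_slice hA h).null_or_conull hlam hP ht
    (measurable_prodMk_right hAm)).resolve_right fun hh => ?_
  have h1 : ∀ᵐ x ∂μ, (x, g) ∉ A := measure_eq_zero_iff_ae_notMem.1 hg
  have h2 : ∀ᵐ x ∂μ, (x, h) ∈ A := hh
  have h3 : ∀ᵐ r ∂μ, r 0 ≠ v n := by
    filter_upwards [ae_splice hlam hP n v h1, ae_splice hlam hP n w h2] with r hr1 hr2 hr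
    refine hr1 hr ((hA _ _ ?_).2 (hr2 (hr.trans hvw)))
    have hsplice : ∀ i, n ≤ i → splice n v r i = splice n w r i := fun i hi => by
      obtain ⟨j, rfl⟩ := Nat.exists_eq_add_of_le hi
      rw [splice_add, splice_add]
    refine ⟨⟨n, hsplice⟩, ?_⟩
    rw [tailCocycle_one_eq hsplice, pathProd_congr t (splice_mem_cyl hr),
      pathProd_congr t (splice_mem_cyl (hr.trans hvw))]
    exact hgh
  refine markov_cyl_ne_zero hlam hP 0 (fun _ => v n) (measure_mono_null (fun r hr => ?_) h3)
  exact fun hne => hne (hr 0 le_rfl)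

lemma slice_null_iff [MeasurableSpace G] (hlam : IsPosDistribution lam)
    (hP : ∀ i, IsPosDistribution (P i)) (h00 : t 0 0 = 1) (h01 : t 0 1 = 1)
    (hAm : MeasurableSet A)
    (hA : ∀ p q, SkewProduct (tailRel (Fin 2)) (tailCocycle 1 t) p q → (p ∈ A ↔ q ∈ A))
    {γ : G} (hγ : γ ∈ Subgroup.closure {t 1 0, t 1 1}) (g : G) :
    markovMeasure lam (fun _ => P) {x | (x, g) ∈ A} = 0 ↔
      markovMeasure lam (fun _ => P) {x | (x, γ * g) ∈ A} = 0 := by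
  have key : ∀ (n : ℕ) (v w : ℕ → Fin 2), v n = w n → ∀ g,
      (markovMeasure lam (fun _ => P) {x | (x, g) ∈ A} = 0 ↔ markovMeasure lam (fun _ => P)
        {x | (x, pathProd t n w / pathProd t n v * g) ∈ A} = 0) := fun n v w hvw g =>
    ⟨slice_null_of_slice_null hlam hP (h00.trans h01.symm) hAm hA hvw rfl,
      slice_null_of_slice_null hlam hP (h00.trans h01.symm) hAm hA hvw.symm (by
        rw [← mul_assoc, div_mul_div_cancel, div_self', one_mul])⟩
  induction hγ using Subgroup.closure_induction generalizing g with
  | mem γ hγ =>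
    rcases hγ with rfl | rfl
    · convert key 2 (extendWord ![0, 0, 0]) (extendWord ![0, 1, 0]) rfl g using 5
      simp [pathProd, Finset.prod_range_succ, extendWord, h00, h01]
    · convert key 3 (extendWord ![0, 0, 1, 0]) (extendWord ![0, 1, 1, 0]) rfl g using 5
      simp [pathProd, Finset.prod_range_succ, extendWord, h00, h01]
  | one => rw [one_mul]
  | mul a b _ _ ha hb => exact mul_assoc a b g ▸ (hb g).trans (ha (b * g))
  | inv a _ ha => simpa only [mul_inv_cancel_left] using (ha (a⁻¹ * g)).symm

lemma isErgodicRel_skewProduct [MeasurableSpace G] (hlam : IsPosDistribution lam)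
    (hP : ∀ i, IsPosDistribution (P i)) (h00 : t 0 0 = 1) (h01 : t 0 1 = 1)
    (ν : Measure G) [SFinite ν]
    (hν : ∀ E, MeasurableSet E → (∀ γ ∈ Subgroup.closure {t 1 0, t 1 1}, ∀ g,
      g ∈ E ↔ γ * g ∈ E) → ν E = 0 ∨ ν Eᶜ = 0) :
    IsErgodicRel (SkewProduct (tailRel (Fin 2)) (tailCocycle 1 t))
      ((markovMeasure lam fun _ => P).prod ν) := by
  intro A hAm hA
  set μ := markovMeasure lam fun _ => P with hμ
  have hE : MeasurableSet {g | μ {x | (x, g) ∈ A} = 0} :=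
    measurable_measure_prodMk_right hAm (measurableSet_singleton 0)
  rcases hν _ hE fun γ hγ g => slice_null_iff hlam hP h00 h01 hAm hA hγ g with h | h
  · right
    rw [Measure.prod_apply_symm hAm.compl, lintegral_eq_zero_iff
      (measurable_measure_prodMk_right hAm.compl)]
    filter_upwards [measure_eq_zero_iff_ae_notMem.1 h] with g hg
    exact ((isExchangeable_slice hA g).null_or_conull hlam hP (h00.trans h01.symm)
      (measurable_prodMk_right hAm)).resolve_left hg
  · left
    rw [Measure.prod_apply_symm hAm, lintegral_eq_zero_iff (measurable_measure_prodMk_right hAm)]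
    exact h

end Skew

/-! ### Coboundaries -/

/-- Ergodicity of a cocycle passes to cohomologous ones. -/
lemma IsErgodicRel.of_coboundary {X G : Type*} [MeasurableSpace X] [CommGroup G]
    [MeasurableSpace G] [MeasurableMul₂ G] {R : Setoid X} {μ : Measure X} [SFinite μ]
    {ν : Measure G} [SFinite ν] [ν.IsMulLeftInvariant] {α β : X → X → G} {φ : X → G}
    (hφ : Measurable φ) (h : ∀ x y, R x y → α x y = (φ x)⁻¹ * β x y * φ y)
    (hβ : IsErgodicRel (SkewProduct R β) (μ.prod ν)) :
    IsErgodicRel (SkewProduct R α) (μ.prod ν) := by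
  intro A hAm hA
  have hmp : MeasurePreserving (fun p : X × G => (p.1, φ p.1 * p.2)) (μ.prod ν) (μ.prod ν) :=
    (MeasurePreserving.id μ).skew_product (g := fun x g => φ x * g)
      ((hφ.comp measurable_fst).mul measurable_snd)
      (Eventually.of_forall fun x => map_mul_left_eq_self ν (φ x))
  rw [← hmp.measure_preimage hAm.nullMeasurableSet,
    ← hmp.measure_preimage hAm.compl.nullMeasurableSet]
  refine hβ _ (hmp.measurable hAm) ?_
  rintro ⟨x, g⟩ ⟨y, k⟩ ⟨hxy, hk⟩
  refine hA _ _ ⟨hxy, ?_⟩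
  simp only at hk hxy ⊢
  rw [h x y hxy, hk]
  group
  simp [mul_comm, mul_left_comm]

lemma tailCocycle_eq_coboundary_mul {G : Type*} [CommGroup G] {t₀ ψ : Fin 2 → G}
    {p t : Fin 2 → Fin 2 → G} {c : G} (h : ∀ i j, p i j = c * (ψ j / ψ i) * t i j)
    {x y : ℕ → Fin 2} (hxy : tailRel (Fin 2) x y) :
    tailCocycle t₀ p x y =
      (t₀ (x 0) / ψ (x 0))⁻¹ * tailCocycle 1 t x y * (t₀ (y 0) / ψ (y 0)) := by
  obtain ⟨n, hn⟩ := hxy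
  have key : ∀ z : ℕ → Fin 2, pathProd p n z = c ^ n * (ψ (z n) / ψ (z 0)) * pathProd t n z := by
    intro z
    rw [pathProd, Finset.prod_congr rfl fun i _ => h _ _, Finset.prod_mul_distrib,
      Finset.prod_mul_distrib, Finset.prod_const, Finset.card_range,
      Finset.prod_range_div (fun i => ψ (z i))]
    rfl
  rw [tailCocycle_eq hn, tailCocycle_one_eq hn, wordWeight, wordWeight, key, key, hn n le_rfl]
  simp only [div_eq_mul_inv, mul_inv, inv_inv]
  generalize t₀ (x 0) = a, t₀ (y 0) = b, ψ (y 0) = d, ψ (x 0) = e, ψ (y n) = f,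
    pathProd t n y = k, pathProd t n x = m, c ^ n = q
  calc _ = (a⁻¹ * e * (k * m⁻¹) * (b * d⁻¹)) * (q * q⁻¹) * (f * f⁻¹) := by
        simp only [mul_comm, mul_left_comm, mul_assoc]
    _ = _ := by simp

/-! ### The types -/

section Types

variable {lam : Fin 2 → ℝ} {P : Matrix (Fin 2) (Fin 2) ℝ}

/-- The transition weights `P i j`, normalized by a coboundary such that the transitions out of
`0` have weight `1`. -/
def normalizedStep (hP : ∀ i, IsPosDistribution (P i)) (i j : Fin 2) : PosReal :=
  if i = 0 then 1 else if j = 0 then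
    ⟨P 0 0 ^ 2 / (P 0 1 * P 1 0), div_pos (pow_pos ((hP 0).1 0) 2)
      (mul_pos ((hP 0).1 1) ((hP 1).1 0))⟩⁻¹
  else ⟨P 0 0 / P 1 1, div_pos ((hP 0).1 0) ((hP 1).1 1)⟩⁻¹

lemma closure_normalizedStep (hP : ∀ i, IsPosDistribution (P i)) :
    Subgroup.closure {normalizedStep hP 1 0, normalizedStep hP 1 1} =
      ratioGroup P fun i => (hP i).1 := by
  apply le_antisymm
  · rw [Subgroup.closure_le]
    rintro _ (rfl | rfl)
    · exact inv_mem (Subgroup.subset_closure (Or.inr rfl))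
    · exact inv_mem (Subgroup.subset_closure (Or.inl rfl))
  · rw [ratioGroup, Subgroup.closure_le]
    rintro _ (rfl | rfl)
    · exact inv_mem_iff.1 (Subgroup.subset_closure (Or.inr rfl))
    · exact inv_mem_iff.1 (Subgroup.subset_closure (Or.inl rfl))

lemma normalizedStep_mem (hP : ∀ i, IsPosDistribution (P i)) (i j : Fin 2) :
    normalizedStep hP i j ∈ ratioGroup P fun i => (hP i).1 := by
  rw [← closure_normalizedStep hP]
  fin_cases i
  · exact one_mem _
  · fin_cases j
    · exact Subgroup.subset_closure (Or.inl rfl)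
    · exact Subgroup.subset_closure (Or.inr rfl)

/-- The transfer function of the coboundary that normalizes the transition weights. -/
def normalizer (hP : ∀ i, IsPosDistribution (P i)) (i : Fin 2) : PosReal :=
  if i = 0 then 1 else ⟨P 0 1 / P 0 0, div_pos ((hP 0).1 1) ((hP 0).1 0)⟩

lemma step_eq_normalizedStep (hP : ∀ i, IsPosDistribution (P i)) (i j : Fin 2) :
    (⟨P i j, (hP i).1 j⟩ : PosReal) =
      ⟨P 0 0, (hP 0).1 0⟩ * (normalizer hP j / normalizer hP i) * normalizedStep hP i j := by
  have h00 := (hP 0).1 0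
  have h01 := (hP 0).1 1
  have h10 := (hP 1).1 0
  have h11 := (hP 1).1 1
  apply Subtype.ext
  fin_cases i <;> fin_cases j <;>
    simp [normalizedStep, normalizer, div_eq_mul_inv, Positive.val_mul, Positive.coe_inv] <;>
    field_simp

lemma markovCocycle_eq (hlam : IsPosDistribution lam) (hP : ∀ i, IsPosDistribution (P i))
    {x y : ℕ → Fin 2} (hxy : tailRel (Fin 2) x y) :
    markovCocycle hlam hP x y =
      ((⟨lam (x 0), hlam.1 _⟩ : PosReal) / normalizer hP (x 0))⁻¹ *
        tailCocycle 1 (normalizedStep hP) x y *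
        ((⟨lam (y 0), hlam.1 _⟩ : PosReal) / normalizer hP (y 0)) :=
  tailCocycle_eq_coboundary_mul (step_eq_normalizedStep hP) hxy

lemma measurable_transfer (hlam : IsPosDistribution lam) (hP : ∀ i, IsPosDistribution (P i)) :
    Measurable fun x : ℕ → Fin 2 => (⟨lam (x 0), hlam.1 _⟩ : PosReal) / normalizer hP (x 0) :=
  measurable_of_forall_mem_cyl 0 fun x y h => by rw [h 0 le_rfl]

theorem isTypeIIIone_markov (hlam : IsPosDistribution lam) (hP : ∀ i, IsPosDistribution (P i))
    (hd : Dense (ratioGroup P fun i => (hP i).1 : Set PosReal)) :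
    IsTypeIIIone (tailRel (Fin 2)) (markovMeasure lam fun _ => P) := by
  refine ⟨isErgodicNonsingular_markov hlam hP, markovCocycle hlam hP,
    isRadonNikodymCocycle_markovCocycle hlam hP, Measure.haar, inferInstance, ?_⟩
  refine IsErgodicRel.of_coboundary (measurable_transfer hlam hP)
    (fun x y hxy => markovCocycle_eq hlam hP hxy) ?_
  refine isErgodicRel_skewProduct hlam hP rfl rfl _ fun E hE hinv => ?_
  rw [closure_normalizedStep] at hinv
  exact null_or_conull_of_dense _ hd hE hinv

lemma coe_tailCocycle_one {G : Type*} [CommGroup G] {S : Subgroup G} (t : Fin 2 → Fin 2 → S)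
    (x y : ℕ → Fin 2) :
    ((tailCocycle 1 t x y : S) : G) = tailCocycle 1 (fun i j => (t i j : G)) x y := by
  simp [tailCocycle, wordWeight, pathProd]

theorem isTypeIIIlam_markov (hlam : IsPosDistribution lam) (hP : ∀ i, IsPosDistribution (P i))
    {l : PosReal} (hl : l < 1) (hG : ratioGroup P (fun i => (hP i).1) = Subgroup.zpowers l) :
    IsTypeIIIlam (tailRel (Fin 2)) (markovMeasure lam fun _ => P) l := by
  have hmem : ∀ i j, normalizedStep hP i j ∈ Subgroup.zpowers l :=
    fun i j => hG ▸ normalizedStep_mem hP i j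
  set t : Fin 2 → Fin 2 → Subgroup.zpowers l := fun i j => ⟨_, hmem i j⟩ with ht
  refine ⟨isErgodicNonsingular_markov hlam hP, hl, markovCocycle hlam hP,
    isRadonNikodymCocycle_markovCocycle hlam hP, tailCocycle 1 t, isCocycle_tailCocycle _, ?_, ?_⟩
  · refine ⟨_, measurable_transfer hlam hP, Set.univ, MeasurableSet.univ, by simp,
      fun x _ y _ hxy => ?_⟩
    refine (markovCocycle_eq hlam hP hxy).trans ?_
    simp only [coe_tailCocycle_one, ht]
  · have := discreteTopology_zpowers hl
    refine ⟨Measure.haar, inferInstance, ?_⟩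
    refine isErgodicRel_skewProduct hlam hP (Subtype.ext rfl) (Subtype.ext rfl) _
      fun E _ hinv => ?_
    have htop : Subgroup.closure {t 1 0, t 1 1} = ⊤ := by
      apply Subgroup.map_injective (Subgroup.subtype_injective _)
      rw [MonoidHom.map_closure, Set.image_pair, ← MonoidHom.range_eq_map, Subgroup.range_subtype]
      exact (closure_normalizedStep hP).trans hG
    rcases E.eq_empty_or_nonempty with rfl | ⟨g, hg⟩
    · exact Or.inl measure_empty
    · right
      have : E = Set.univ := Set.eq_univ_of_forall fun h => by
        have := (hinv (h * g⁻¹) (htop ▸ Subgroup.mem_top _) g).1 hg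
        rwa [inv_mul_cancel_right] at this
      rw [this, Set.compl_univ, measure_empty]

theorem isTypeIIone_markov (hlam : IsPosDistribution lam) (hP : ∀ i, IsPosDistribution (P i))
    (hG : ratioGroup P (fun i => (hP i).1) = ⊥) :
    IsTypeIIone (tailRel (Fin 2)) (markovMeasure lam fun _ => P) := by
  have hhalf : ∀ i j, P i j = 1 / 2 := by
    rw [ratioGroup, Subgroup.closure_eq_bot_iff, Set.pair_subset_iff] at hG
    have h1 : P 0 0 / P 1 1 = 1 := congrArg Subtype.val (Set.mem_singleton_iff.1 hG.1)
    have h2 : P 0 0 ^ 2 / (P 0 1 * P 1 0) = 1 :=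
      congrArg Subtype.val (Set.mem_singleton_iff.1 hG.2)
    have h00 := (hP 0).1 0
    have h01 := (hP 0).1 1
    have h10 := (hP 1).1 0
    have h11 := (hP 1).1 1
    have h0 := (hP 0).2
    have h3 := (hP 1).2
    rw [div_eq_one_iff_eq h11.ne'] at h1
    rw [div_eq_one_iff_eq (by positivity)] at h2
    have h4 : P 0 0 = 1 / 2 := by
      have e1 : P 0 1 = 1 - P 0 0 := by linarith
      have e2 : P 1 0 = 1 - P 0 0 := by linarith
      rw [e1, e2] at h2
      nlinarith
    intro i j
    fin_cases i <;> fin_cases j <;> simp only [Fin.mk_one, Fin.zero_eta] <;> linarith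
  have hu : IsPosDistribution fun _ => 1 / 2 := ⟨fun _ => by norm_num, by norm_num⟩
  have hmeas : Measurable fun x : ℕ → Fin 2 => ENNReal.ofReal (2 * lam (x 0)) :=
    measurable_of_forall_mem_cyl 0 fun x y h => by rw [h 0 le_rfl]
  have hdens : markovMeasure lam (fun _ => P) =
      (markovMeasure (fun _ => 1 / 2) fun _ => P).withDensity fun x =>
        ENNReal.ofReal (2 * lam (x 0)) := by
    refine ext_of_cyl 0 fun k _ a => ?_
    rw [withDensity_apply _ (measurableSet_cyl k a),
      setLIntegral_congr_fun (measurableSet_cyl k a) fun x hx => by rw [hx 0 (Nat.zero_le _)],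
      setLIntegral_const, markov_cyl hlam hP, markov_cyl hu hP,
      ← ENNReal.ofReal_mul (mul_pos two_pos (hlam.1 _)).le]
    congr 1
    ring
  refine ⟨isErgodicNonsingular_markov hlam hP, markovMeasure (fun _ => 1 / 2) fun _ => P,
    inferInstance, ?_, ?_, finiteTranslations, generates_finiteTranslations, ?_⟩
  · rw [hdens]
    refine withDensity_absolutelyContinuous' hmeas.aemeasurable (ae_of_all _ fun x => ?_)
    rw [Ne, ENNReal.ofReal_eq_zero, not_le]
    exact mul_pos two_pos (hlam.1 _)
  · rw [hdens]
    exact withDensity_absolutelyContinuous _ _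
  · rintro _ ⟨s, rfl⟩
    have : IsFiniteMeasure ((markovMeasure (fun _ => 1 / 2) fun _ => P).map
        (Equiv.addLeft (s : ℕ → Fin 2))) := Measure.isFiniteMeasure_map _ _
    refine ext_of_cyl 0 fun k _ a => ?_
    refine (Measure.map_apply (measurable_addLeft s) (measurableSet_cyl k a)).trans ?_
    rw [preimage_add_cyl, markov_cyl hu hP, markov_cyl hu hP]
    simp only [pathProd, hhalf]

end Types

end OrbitType

end

open OrbitType
/-- The type of the tail relation with a Markov measure whose transition matrices are all `P`. -/
theorem proposition6p1 (lam : Fin 2 → ℝ) (hlam : IsPosDistribution lam)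
    (P : Matrix (Fin 2) (Fin 2) ℝ) (hP : ∀ i j, 0 < P i j) (hP1 : ∀ i, P i 0 + P i 1 = 1) :
    IsErgodicRel (tailRel (Fin 2)) (markovMeasure lam fun _ => P) ∧
      (ratioGroup P hP = ⊥ →
        IsTypeIIone (tailRel (Fin 2)) (markovMeasure lam fun _ => P)) ∧
      (∀ l : PosReal, l < 1 → ratioGroup P hP = Subgroup.zpowers l →
        IsTypeIIIlam (tailRel (Fin 2)) (markovMeasure lam fun _ => P) l) ∧
      (Dense (ratioGroup P hP : Set PosReal) →
        IsTypeIIIone (tailRel (Fin 2)) (markovMeasure lam fun _ => P)) := by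
  have h : ∀ i, IsPosDistribution (P i) := fun i => ⟨hP i, hP1 i⟩
  exact ⟨isErgodicRel_markov hlam h, isTypeIIone_markov hlam h,
    fun _ hl hG => isTypeIIIlam_markov hlam h hl hG, isTypeIIIone_markov hlam h⟩
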